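/- Let $a,\alpha,\beta,\gamma,n\in\mathbb{C}$, put $\kappa=\alpha+\beta+\gamma+2n$, and assume $a\neq 0,1$ and $\kappa\neq 0$. On $U_1=\{(x,y,z)\in\mathbb{C}^3: x\neq 0\}$ consider the autonomous system $$x'=\frac{\left(\kappa+\beta+2ay-a(\alpha+\beta)-2(a-1)z\right)x-\kappa(\beta+2z)+(a-1)x^2}{(a-1)a},\qquad z'=\frac{a\,y'}{a-1},$$ $$y'=\frac{1}{a^2\kappa x}\Big[a\big((a-1)n(\gamma+n)+((a-1)\gamma+2(a-1)n-\alpha)y+ay^2\big)x^2-\big((a-1)x^2(a(\gamma+2n)+\beta+2ay)+\beta\kappa^2\big)z-\big(\kappa^2-(a-1)^2x^2\big)z^2\Big],$$ and let $$\begin{aligned}h_a={}&axy\big((a\gamma+2an-\alpha-\gamma-2n+ay-2(a-1)z)x+\kappa(\alpha+\gamma+2n-2z)\big)\\&+(\kappa+(a-1)x)\big(x(an(\gamma+n)-(a\gamma+2an+\beta)z+(a-1)z^2)+\kappa(\beta+z)z\big).\end{aligned}$$ Let $U_2=\{(x,y,z)\in U_1: h_a(x,y,z)\neq 0\}$. Then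 the following hold. 1. $\mathcal I_1=ay-(a-1)z$ and $\mathcal I_2=h_a/x$ are holomorphic first integrals on $U_1$, and they are functionally independent: their differentials are linearly independent on a dense subset of $U_1$. 2. The system preserves the volume forms $\Omega^{(1)}=\frac{dx\wedge dy\wedge dz}{x}$ on $U_1$ and $\Omega^{(2)}=\frac{dx\wedge dy\wedge dz}{h_a}$ on $U_2$. 3. The level curves of the integrals form an elliptic fibration: every set $\{p\in U_1:\mathcal I_1(p)=\iota_1,\ \mathcal I_2(p)=\iota_2\}$ with $(\iota_1,\iota_2)\in\mathbb{C}^2$ is non-empty, and there is a polynomial $D(\iota_1,\iota_2)$, not vanishing identically on any line $\iota_1=\mathrm{const}$, such that whenever $D(\iota_1,\iota_2)\neq0$ this set is a smooth (i.e. $d\mathcal I_1,d\mathcal I_2$ are linearly independent at all of its points) irreducible affine curve birational to an elliptic curve over $\mathbb{C}$, that is, a curve of genus one. 4. For $i,j\in\{1,2\}$ let $\tau^{(i)}$ be the trivector dual to $\Omega^{(i)}$, normalised by $\sum_{k,l,m}\tau^{(i)}_{klm}\Omega^{(i)}_{klm}=1$, and let $J^{(i)}_j$ be its contraction with $d\mathcal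 I_j$, with components $\sum_m \tau^{(i)}_{klm}\,\partial_m\mathcal I_j$. Then for each $i$, $(J^{(i)}_1,J^{(i)}_2)$ is a pair of compatible Poisson structures on $U_i$ (all linear combinations with constant coefficients are Poisson), and the system is Hamiltonian with respect to all four: $\vec x\,'=J^{(i)}_j\nabla H^{(i)}_j$ with, for $c=\frac{6}{a^2(a-1)\kappa}$, $$H^{(1)}_1=c\,\mathcal I_2,\quad H^{(1)}_2=-c\,\mathcal I_1,\quad H^{(2)}_1=c\log\mathcal I_2,\quad H^{(2)}_2=-c\,\frac{\mathcal I_1}{\mathcal I_2},$$ where near each point of $U_2$ the function $\log\mathcal I_2$ is a local holomorphic branch of the logarithm. -/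

import Mathlib

noncomputable section

namespace AutonomousLimit

/-- Affine three-space over the complex numbers, with coordinates `(x, y, z) = (p 0, p 1, p 2)`. -/
abbrev C3 : Type := Fin 3 → ℂ

/-! ### Differential calculus and Poisson geometry on open subsets of complex three-space -/

/-- The holomorphic partial derivative in the `i`-th coordinate direction. -/
def pderiv (i : Fin 3) (f : C3 → ℂ) (p : C3) : ℂ :=
  fderiv ℂ f p (Pi.single i 1)

/-- The holomorphic gradient, the coordinate vector of the differential of `f`. -/
def grad (f : C3 → ℂ) (p : C3) : C3 := fun i => pderiv i f p

/-- `I` is a first integral on `U` of the system `p' = F p`: it is holomorphic and its derivative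
along the vector field `F` vanishes. -/
def IsFirstIntegral (F : C3 → C3) (U : Set C3) (I : C3 → ℂ) : Prop :=
  DifferentiableOn ℂ I U ∧ ∀ p ∈ U, fderiv ℂ I p (F p) = 0

/-- Functional independence on `U`: the differentials are linearly independent on a dense subset
of `U`. -/
def FunctionallyIndependent (U : Set C3) (I₁ I₂ : C3 → ℂ) : Prop :=
  U ⊆ closure {p ∈ U | LinearIndependent ℂ ![fderiv ℂ I₁ p, fderiv ℂ I₂ p]}

/-- `w dx ∧ dy ∧ dz` is a holomorphic volume form on `U` (its density `w` is holomorphic and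
nowhere zero) that is preserved by `F`: its Lie derivative
`(∑ i, ∂ (w F i) / ∂ (p i)) dx ∧ dy ∧ dz` along `F` is zero on `U`. -/
def PreservesVolume (F : C3 → C3) (U : Set C3) (w : C3 → ℂ) : Prop :=
  DifferentiableOn ℂ w U ∧ (∀ p ∈ U, w p ≠ 0) ∧
    ∀ p ∈ U, ∑ i, pderiv i (fun q => w q * F q i) p = 0

/-- `J` is a holomorphic Poisson tensor on `U`: its components are holomorphic, it is
skew-symmetric, and the bracket `{f, g} = ∑ i j, J i j ∂ᵢf ∂ⱼg` satisfies the Jacobi identity. -/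
def IsPoissonTensor (U : Set C3) (J : C3 → Matrix (Fin 3) (Fin 3) ℂ) : Prop :=
  (∀ i j, DifferentiableOn ℂ (fun p => J p i j) U) ∧
  (∀ p ∈ U, (J p).transpose = -J p) ∧
  ∀ p ∈ U, ∀ i j k : Fin 3,
    ∑ l, (J p i l * pderiv l (fun q => J q j k) p + J p j l * pderiv l (fun q => J q k i) p
      + J p k l * pderiv l (fun q => J q i j) p) = 0

/-- A pair of compatible Poisson structures on `U`: both tensors, and all their linear combinations
with constant coefficients, are Poisson tensors. -/
def IsPoissonPair (U : Set C3) (J₁ J₂ : C3 → Matrix (Fin 3) (Fin 3) ℂ) : Prop :=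
  IsPoissonTensor U J₁ ∧ IsPoissonTensor U J₂ ∧
    ∀ c₁ c₂ : ℂ, IsPoissonTensor U (fun p => c₁ • J₁ p + c₂ • J₂ p)

/-- On `U` the system `p' = F p` is Hamiltonian with respect to `J`, with the holomorphic
Hamiltonian function `H`. -/
def IsHamiltonianOn (F : C3 → C3) (U : Set C3) (J : C3 → Matrix (Fin 3) (Fin 3) ℂ)
    (H : C3 → ℂ) : Prop :=
  DifferentiableOn ℂ H U ∧ ∀ p ∈ U, F p = (J p).mulVec (grad H p)

/-- The trivector `τ` dual to the volume form `w dx ∧ dy ∧ dz`, as an alternating function of three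
covectors. It is normalised by `∑ k l m, τ k l m * Ω k l m = 1`, see `trivector_contract`. -/
def trivector (w : C3 → ℂ) (p : C3) (ξ η ζ : C3) : ℂ :=
  (6 * w p)⁻¹ * Matrix.det (Matrix.of ![ξ, η, ζ])

theorem trivector_contract (w : C3 → ℂ) (p : C3) (hw : w p ≠ 0) :
    ∑ k : Fin 3, ∑ l : Fin 3, ∑ m : Fin 3,
      trivector w p (Pi.single k 1) (Pi.single l 1) (Pi.single m 1)
        * (w p * Matrix.det (Matrix.of
          ![(Pi.single k 1 : C3), Pi.single l 1, Pi.single m 1])) = 1 := by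
  simp [trivector, Matrix.det_fin_three, Fin.sum_univ_three]
  field_simp
  norm_num

/-- The bivector obtained by contracting with `dI` the trivector dual to `w dx ∧ dy ∧ dz`. -/
def contractedTensor (w I : C3 → ℂ) (p : C3) : Matrix (Fin 3) (Fin 3) ℂ :=
  Matrix.of fun k l => trivector w p (Pi.single k 1) (Pi.single l 1) (grad I p)

/-! ### Level curves and elliptic fibrations -/

/-- The common level set in `U` of two functions. -/
def levelCurve (U : Set C3) (I₁ I₂ : C3 → ℂ) (ι₁ ι₂ : ℂ) : Set C3 :=
  {p ∈ U | I₁ p = ι₁ ∧ I₂ p = ι₂}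

/-- The coordinate ring of (the Zariski closure of) a subset of affine three-space. -/
abbrev CoordRing (V : Set C3) : Type :=
  MvPolynomial (Fin 3) ℂ ⧸ MvPolynomial.vanishingIdeal ℂ V

/-- `V` is irreducible and birationally equivalent to an elliptic curve over `ℂ`: its function
field is isomorphic over `ℂ` to the function field of an elliptic curve. -/
def IsBirationallyElliptic (V : Set C3) : Prop :=
  (MvPolynomial.vanishingIdeal ℂ V).IsPrime ∧
    ∃ W : WeierstrassCurve ℂ, W.IsElliptic ∧
      Nonempty (FractionRing (CoordRing V) ≃ₐ[ℂ] W.toAffine.FunctionField)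

/-- The map `(I₁, I₂) : U → ℂ²` is an elliptic fibration: all its fibres are non-empty, and the
general fibre is a smooth irreducible curve birational to an elliptic curve. General means outside
the zero set of a polynomial `D` in the two values `ι₁, ι₂` which does not vanish identically on
any line `ι₁ = const`. -/
def IsEllipticFibration (U : Set C3) (I₁ I₂ : C3 → ℂ) : Prop :=
  (∀ ι₁ ι₂ : ℂ, (levelCurve U I₁ I₂ ι₁ ι₂).Nonempty) ∧
  ∃ D : MvPolynomial (Fin 2) ℂ,
    (∀ ι₁ : ℂ, ∃ ι₂ : ℂ, MvPolynomial.eval ![ι₁, ι₂] D ≠ 0) ∧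
    ∀ ι₁ ι₂ : ℂ, MvPolynomial.eval ![ι₁, ι₂] D ≠ 0 →
      (∀ p ∈ levelCurve U I₁ I₂ ι₁ ι₂,
        LinearIndependent ℂ ![fderiv ℂ I₁ p, fderiv ℂ I₂ p]) ∧
      IsBirationallyElliptic (levelCurve U I₁ I₂ ι₁ ι₂)

/-! ### The autonomous system -/

/-- The complex parameters of the system. -/
structure Params where
  a : ℂ
  α : ℂ
  β : ℂ
  γ : ℂ
  n : ℂ

/-- The dependent parameter `κ = α + β + γ + 2 n`. -/
def Params.κ (P : Params) : ℂ := P.α + P.β + P.γ + 2 * P.n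

/-- The right-hand side of the equation for `x'`. -/
def fieldX (P : Params) (p : C3) : ℂ :=
  let a := P.a; let α := P.α; let β := P.β; let κ := P.κ
  let x := p 0; let y := p 1; let z := p 2
  ((κ + β + 2 * a * y - a * (α + β) - 2 * (a - 1) * z) * x - κ * (β + 2 * z) + (a - 1) * x ^ 2)
    / ((a - 1) * a)

/-- The right-hand side of the equation for `y'`. -/
def fieldY (P : Params) (p : C3) : ℂ :=
  let a := P.a; let α := P.α; let β := P.β; let γ := P.γ; let n := P.n; let κ := P.κ
  let x := p 0; let y := p 1; let z := p 2
  (a * ((a - 1) * n * (γ + n) + ((a - 1) * γ + 2 * (a - 1) * n - α) * y + a * y ^ 2) * x ^ 2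
      - ((a - 1) * x ^ 2 * (a * (γ + 2 * n) + β + 2 * a * y) + β * κ ^ 2) * z
      - (κ ^ 2 - (a - 1) ^ 2 * x ^ 2) * z ^ 2)
    / (a ^ 2 * κ * x)

/-- The right-hand side `(x', y', z')` of the autonomous system. -/
def field (P : Params) (p : C3) : C3 :=
  ![fieldX P p, fieldY P p, P.a * fieldY P p / (P.a - 1)]

/-- The Darboux polynomial `h_a`. -/
def h (P : Params) (p : C3) : ℂ :=
  let a := P.a; let α := P.α; let β := P.β; let γ := P.γ; let n := P.n; let κ := P.κ
  let x := p 0; let y := p 1; let z := p 2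
  a * x * y * ((a * γ + 2 * a * n - α - γ - 2 * n + a * y - 2 * (a - 1) * z) * x
      + κ * (α + γ + 2 * n - 2 * z))
    + (κ + (a - 1) * x) * (x * (a * n * (γ + n) - (a * γ + 2 * a * n + β) * z + (a - 1) * z ^ 2)
      + κ * (β + z) * z)

/-- The phase space `x ≠ 0` of the system. -/
def U₁ : Set C3 := {p | p 0 ≠ 0}

/-- The complement in the phase space of the surface `h_a = 0`. -/
def U₂ (P : Params) : Set C3 := {p | p 0 ≠ 0 ∧ h P p ≠ 0}

theorem isOpen_U₁ : IsOpen U₁ :=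
  isOpen_ne_fun (continuous_apply 0) continuous_const

theorem isOpen_U₂ (P : Params) : IsOpen (U₂ P) := by
  refine isOpen_U₁.inter (isOpen_ne_fun (f := h P) ?_ continuous_const)
  unfold h
  fun_prop

/-- The first integral `a y - (a - 1) z`. -/
def I₁ (P : Params) (p : C3) : ℂ := P.a * p 1 - (P.a - 1) * p 2

/-- The first integral `h_a / x`. -/
def I₂ (P : Params) (p : C3) : ℂ := h P p / p 0

/-- The density `1 / x` of the first volume form. -/
def w₁ (p : C3) : ℂ := 1 / p 0

/-- The density `1 / h_a` of the second volume form. -/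
def w₂ (P : Params) (p : C3) : ℂ := 1 / h P p

/-- The constant in the Hamiltonian functions. -/
def hamConst (P : Params) : ℂ := 6 / (P.a ^ 2 * (P.a - 1) * P.κ)

end AutonomousLimit

end

/-!
The vector field of the system is a multiple of `∇I₂ × ∇I₁`, the multiplier being
`(hamConst P / 6) * x` (`field_eq_cross`). Hence both functions are first integrals. The fields
`w₁ F` and `w₂ F` are `∇I₂ × ∇I₁` times a constant and times a function of `I₂`, respectively, so
they are divergence-free (`sum_pderiv_mul_cross`). A tensor contracted from a trivector acts as a
cross product with `∇I`, so the four Hamiltonian forms are this same identity, and every such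
tensor is Poisson (`isPoissonTensor_contractedTensor`).

For the fibration, eliminate `y` by `I₁ = c` and put `Z = κ z`. The level curve `I₂ = d` becomes the
plane cubic `Z² + (-b x² + e x + f) Z + q x² + s x = 0` with `b = a - 1` and `s` depending on `d`
(`mem_levelCurve_iff`). As a quadratic in `x` it reads
`(q - b Z) x² + (e Z + s) x + Z² + f Z = 0`, and multiplication by `q - b Z` turns it into a
Weierstrass equation for `X = b Z`, `Y = b x (q - b Z)`. The polynomial `D` is the discriminant of
this Weierstrass curve, which is a quartic in `s` with constant leading coefficient `-27 b⁴`.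

A singular point of the cubic gives a singular point of the Weierstrass curve
(`fibreCubic_smooth`), whence smoothness of the fibres. For the function field, the inverse
substitution maps polynomials in `x, y, z` to functions on the Weierstrass curve. Both curves are
quadratic over a line with two points over almost every base point, so that a polynomial vanishing
at almost all points is divisible by the equation (`quadratic_dvd_of_evalEval_eq_zero`); therefore
the finitely many points at which the birational map is not invertible do not matter, and the
kernel of the substitution is the vanishing ideal of the level curve
(`isBirationallyElliptic_of_fibreCubic`).
-/

noncomputable section

namespace AutonomousLimit

open Polynomial
open scoped Matrix

/-! ### Partial derivatives -/

section pderiv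
variable {f g : C3 → ℂ} {p : C3}

theorem pderiv_add (i : Fin 3) (hf : DifferentiableAt ℂ f p) (hg : DifferentiableAt ℂ g p) :
    pderiv i (fun q => f q + g q) p = pderiv i f p + pderiv i g p := by
  simp [pderiv, fderiv_fun_add hf hg]

theorem pderiv_sub (i : Fin 3) (hf : DifferentiableAt ℂ f p) (hg : DifferentiableAt ℂ g p) :
    pderiv i (fun q => f q - g q) p = pderiv i f p - pderiv i g p := by
  simp [pderiv, fderiv_fun_sub hf hg]

theorem pderiv_mul (i : Fin 3) (hf : DifferentiableAt ℂ f p) (hg : DifferentiableAt ℂ g p) :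
    pderiv i (fun q => f q * g q) p = f p * pderiv i g p + g p * pderiv i f p := by
  simp [pderiv, fderiv_fun_mul hf hg]

theorem pderiv_const (i : Fin 3) (c : ℂ) : pderiv i (fun _ => c) p = 0 := by
  simp [pderiv]

theorem pderiv_const_mul (i : Fin 3) (c : ℂ) (hf : DifferentiableAt ℂ f p) :
    pderiv i (fun q => c * f q) p = c * pderiv i f p := by
  have hc : DifferentiableAt ℂ (fun _ : C3 => c) p := differentiableAt_const c
  rw [pderiv_mul i hc hf, pderiv_const, mul_zero, add_zero]

theorem pderiv_coord (i j : Fin 3) : pderiv i (fun q => q j) p = if j = i then 1 else 0 := by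
  rw [pderiv, (hasFDerivAt_apply (𝕜 := ℂ) j p).fderiv]
  simp [Pi.single_apply]

theorem pderiv_sq (i : Fin 3) (hf : DifferentiableAt ℂ f p) :
    pderiv i (fun q => f q ^ 2) p = 2 * f p * pderiv i f p := by
  simp only [pow_two]
  rw [pderiv_mul i hf hf]; ring

/-- The library's quotient rule is for functions of one scalar variable. -/
theorem differentiableAt_div (hf : DifferentiableAt ℂ f p) (hg : DifferentiableAt ℂ g p)
    (h0 : g p ≠ 0) : DifferentiableAt ℂ (fun q => f q / g q) p := by
  simp only [div_eq_mul_inv]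
  exact hf.mul (hg.fun_inv h0)

theorem pderiv_div (i : Fin 3) (hf : DifferentiableAt ℂ f p) (hg : DifferentiableAt ℂ g p)
    (h0 : g p ≠ 0) :
    pderiv i (fun q => f q / g q) p = (pderiv i f p * g p - f p * pderiv i g p) / g p ^ 2 := by
  have hinv : DifferentiableAt ℂ (fun q => (g q)⁻¹) p := hg.fun_inv h0
  have hone : pderiv i (fun q => g q * (g q)⁻¹) p = 0 := by
    have : (fun q => g q * (g q)⁻¹) =ᶠ[nhds p] fun _ => 1 := by
      filter_upwards [hg.continuousAt.eventually_ne h0] with q hq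
      exact mul_inv_cancel₀ hq
    rw [pderiv, this.fderiv_eq]
    simp
  rw [pderiv_mul i hg hinv] at hone
  have hi : pderiv i (fun q => (g q)⁻¹) p = -pderiv i g p / g p ^ 2 := by
    field_simp at hone ⊢
    linear_combination hone
  simp only [div_eq_mul_inv]
  rw [pderiv_mul i hf hinv, hi]
  field_simp
  ring

theorem fderiv_eq_grad (f : C3 → ℂ) (p v : C3) :
    fderiv ℂ f p v = grad f p ⬝ᵥ v := by
  have hv : v = ∑ i, v i • (Pi.single i 1 : C3) := by
    ext j; simp [Finset.sum_apply, Pi.single_apply]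
  conv_lhs => rw [hv]
  simp [map_sum, dotProduct, grad, pderiv, mul_comm]

theorem _root_.ContDiffAt.differentiableAt_pderiv (hf : ContDiffAt ℂ 2 f p) (i : Fin 3) :
    DifferentiableAt ℂ (pderiv i f) p := by
  have h1 : DifferentiableAt ℂ (fderiv ℂ f) p :=
    (hf.fderiv_right (m := 1) (by norm_num)).differentiableAt (by norm_num)
  exact h1.clm_apply (differentiableAt_const _)

theorem pderiv_comm (hf : ContDiffAt ℂ 2 f p) (i j : Fin 3) :
    pderiv i (pderiv j f) p = pderiv j (pderiv i f) p := by
  have h1 : DifferentiableAt ℂ (fderiv ℂ f) p :=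
    (hf.fderiv_right (m := 1) (by norm_num)).differentiableAt (by norm_num)
  have key : ∀ k l, pderiv k (pderiv l f) p
      = fderiv ℂ (fderiv ℂ f) p (Pi.single k 1) (Pi.single l 1) := by
    intro k l
    have : pderiv l f = fun q => fderiv ℂ f q (Pi.single l 1) := rfl
    rw [pderiv, this, fderiv_clm_apply h1 (differentiableAt_const _)]
    simp
  rw [key, key]
  exact hf.isSymmSndFDerivAt (by simp) _ _

end pderiv

/-! ### Tensors contracted from a trivector -/

theorem contractedTensor_mulVec (w I : C3 → ℂ) (p ξ : C3) :
    (contractedTensor w I p).mulVec ξ = (6 * w p)⁻¹ • (ξ ⨯₃ grad I p) := by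
  ext i
  fin_cases i <;>
  simp [contractedTensor, trivector, Matrix.mulVec, dotProduct, Fin.sum_univ_three,
    Matrix.det_fin_three, crossProduct] <;> ring

theorem contractedTensor_apply (w I : C3 → ℂ) (p : C3) (k l : Fin 3) :
    contractedTensor w I p k l = (6 * w p)⁻¹ *
      (!![0, pderiv 2 I p, -pderiv 1 I p; -pderiv 2 I p, 0, pderiv 0 I p;
        pderiv 1 I p, -pderiv 0 I p, 0] : Matrix (Fin 3) (Fin 3) ℂ) k l := by
  fin_cases k <;> fin_cases l <;>
  simp [contractedTensor, trivector, Matrix.det_fin_three, grad]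

/-- In three dimensions a bivector proportional to the Hodge dual of a closed one-form `dI` is
Poisson, whatever the factor of proportionality: in the Jacobiator the derivatives of the factor
cancel, and what remains is antisymmetric in the second derivatives of `I`. -/
theorem isPoissonTensor_contractedTensor {U : Set C3} {w I : C3 → ℂ}
    (hw : ∀ p ∈ U, DifferentiableAt ℂ w p) (hw0 : ∀ p ∈ U, w p ≠ 0)
    (hI : ∀ p ∈ U, ContDiffAt ℂ 2 I p) :
    IsPoissonTensor U (contractedTensor w I) := by
  have hr : ∀ p ∈ U, DifferentiableAt ℂ (fun q => (6 * w q)⁻¹) p := fun p hp =>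
    ((hw p hp).const_mul 6).fun_inv (mul_ne_zero (by norm_num) (hw0 p hp))
  refine ⟨?_, ?_, ?_⟩
  · intro i j p hp
    refine DifferentiableAt.differentiableWithinAt ?_
    simp only [contractedTensor_apply]
    refine (hr p hp).mul ?_
    have := fun k => (hI p hp).differentiableAt_pderiv k
    fin_cases i <;> fin_cases j <;> simp <;> exact this _
  · intro p hp
    ext k l
    simp only [Matrix.transpose_apply, Matrix.neg_apply, contractedTensor_apply]
    fin_cases k <;> fin_cases l <;> simp
  · intro p hp i j k
    have hd := fun k => (hI p hp).differentiableAt_pderiv k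
    have key : ∀ l i j, pderiv l (fun q => contractedTensor w I q i j) p =
        (6 * w p)⁻¹ * (!![0, pderiv l (pderiv 2 I) p, -pderiv l (pderiv 1 I) p;
          -pderiv l (pderiv 2 I) p, 0, pderiv l (pderiv 0 I) p;
          pderiv l (pderiv 1 I) p, -pderiv l (pderiv 0 I) p, 0] :
            Matrix (Fin 3) (Fin 3) ℂ) i j
        + pderiv l (fun q => (6 * w q)⁻¹) p *
          (!![0, pderiv 2 I p, -pderiv 1 I p; -pderiv 2 I p, 0, pderiv 0 I p;
            pderiv 1 I p, -pderiv 0 I p, 0] : Matrix (Fin 3) (Fin 3) ℂ) i j := by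
      have hneg : ∀ l m, pderiv l (fun q => -pderiv m I q) p = -pderiv l (pderiv m I) p := by
        intro l m
        change fderiv ℂ (fun q => -pderiv m I q) p _ = _
        rw [fderiv_fun_neg]
        rfl
      intro l i j
      simp only [contractedTensor_apply]
      rw [pderiv_mul l (hr p hp), mul_comm (pderiv l _ p)]
      · congr 2
        fin_cases i <;> fin_cases j <;> simp [pderiv_const, hneg]
      · fin_cases i <;> fin_cases j <;> simp <;> exact hd _
    simp only [key]
    simp only [contractedTensor_apply, Fin.sum_univ_three]
    have h01 := pderiv_comm (hI p hp) 0 1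
    have h02 := pderiv_comm (hI p hp) 0 2
    have h12 := pderiv_comm (hI p hp) 1 2
    fin_cases i <;> fin_cases j <;> fin_cases k <;>
      simp [h01, h02, h12] <;> ring

/-- Contraction is linear in the function, so a linear combination of two contracted tensors is
the contracted tensor of a linear combination. -/
theorem isPoissonPair_contractedTensor {U : Set C3} {w I J : C3 → ℂ}
    (hw : ∀ p ∈ U, DifferentiableAt ℂ w p) (hw0 : ∀ p ∈ U, w p ≠ 0)
    (hI : ∀ p ∈ U, ContDiffAt ℂ 2 I p) (hJ : ∀ p ∈ U, ContDiffAt ℂ 2 J p) (hU : IsOpen U) :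
    IsPoissonPair U (contractedTensor w I) (contractedTensor w J) := by
  refine ⟨isPoissonTensor_contractedTensor hw hw0 hI, isPoissonTensor_contractedTensor hw hw0 hJ,
    fun c₁ c₂ => ?_⟩
  have hc := isPoissonTensor_contractedTensor (I := fun q => c₁ * I q + c₂ * J q) hw hw0
    fun p hp => (contDiffAt_const.mul (hI p hp)).add (contDiffAt_const.mul (hJ p hp))
  have heq : Set.EqOn (contractedTensor w fun q => c₁ * I q + c₂ * J q)
      (fun p => c₁ • contractedTensor w I p + c₂ • contractedTensor w J p) U := by
    intro p hp
    have hi := (hI p hp).differentiableAt (by norm_num)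
    have hj := (hJ p hp).differentiableAt (by norm_num)
    ext k l
    simp only [Matrix.add_apply, Matrix.smul_apply, contractedTensor_apply,
      fun i => pderiv_add i (hi.const_mul c₁) (hj.const_mul c₂),
      fun i => pderiv_const_mul i c₁ hi, fun i => pderiv_const_mul i c₂ hj, smul_eq_mul]
    fin_cases k <;> fin_cases l <;> simp <;> ring
  have hpd : ∀ p ∈ U, ∀ l i j,
      pderiv l (fun q => (c₁ • contractedTensor w I q + c₂ • contractedTensor w J q) i j) p
      = pderiv l (fun q => contractedTensor w (fun q => c₁ * I q + c₂ * J q) q i j) p := by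
    intro p hp l i j
    have : (fun q => (c₁ • contractedTensor w I q + c₂ • contractedTensor w J q) i j)
        =ᶠ[nhds p] (fun q => contractedTensor w (fun q => c₁ * I q + c₂ * J q) q i j) := by
      filter_upwards [hU.mem_nhds hp] with q hq
      rw [heq hq]
    rw [pderiv, this.fderiv_eq, pderiv]
  refine ⟨fun i j => (hc.1 i j).congr fun p hp => ?_, fun p hp => ?_, fun p hp i j k => ?_⟩
  · rw [heq hp]
  · have := hc.2.1 p hp
    rwa [heq hp] at this
  · have := hc.2.2 p hp i j k
    simpa only [hpd p hp, heq hp] using this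

/-! ### The vector field as a cross product of gradients -/

theorem grad_I₁ (P : Params) (p : C3) : grad (I₁ P) p = ![0, P.a, -(P.a - 1)] := by
  have : I₁ P = fun q => P.a * q 1 - (P.a - 1) * q 2 := rfl
  ext i
  rw [grad, this]
  simp (disch := fun_prop) only [pderiv_sub, pderiv_const_mul, pderiv_coord]
  fin_cases i <;> simp

theorem differentiable_h (P : Params) : Differentiable ℂ (h P) := by
  unfold h; fun_prop

theorem contDiff_h (P : Params) : ContDiff ℂ 2 (h P) := by
  unfold h; fun_prop

theorem contDiff_I₁ (P : Params) : ContDiff ℂ 2 (I₁ P) := by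
  unfold I₁; fun_prop

theorem contDiffAt_I₂ (P : Params) {p : C3} (hp : p ∈ U₁) : ContDiffAt ℂ 2 (I₂ P) p :=
  (contDiff_h P).contDiffAt.div (contDiff_apply ℂ ℂ (0 : Fin 3)).contDiffAt hp

theorem grad_I₂ (P : Params) {p : C3} (hp : p ∈ U₁) (i : Fin 3) :
    grad (I₂ P) p i = (pderiv i (h P) p * p 0 - h P p * if 0 = i then 1 else 0) / p 0 ^ 2 := by
  have : I₂ P = fun q => h P q / q 0 := rfl
  rw [grad, this, pderiv_div (g := fun q => q 0) i (differentiable_h P p) (by fun_prop) hp, pderiv_coord]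

theorem grad_h (P : Params) (p : C3) :
    grad (h P) p =
      let a := P.a; let α := P.α; let β := P.β; let γ := P.γ; let n := P.n; let κ := P.κ
      let x := p 0; let y := p 1; let z := p 2
      let L := a * γ + 2 * a * n - α - γ - 2 * n + a * y - 2 * (a - 1) * z
      let M := κ * (α + γ + 2 * n - 2 * z)
      let Q := a * n * (γ + n) - (a * γ + 2 * a * n + β) * z + (a - 1) * z ^ 2
      ![a * y * (2 * L * x + M) + (a - 1) * (x * Q + κ * (β + z) * z) + (κ + (a - 1) * x) * Q,
        a * x * (L * x + M) + a ^ 2 * x ^ 2 * y,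
        -2 * a * x * y * ((a - 1) * x + κ) + (κ + (a - 1) * x) *
          (x * (-(a * γ + 2 * a * n + β) + 2 * (a - 1) * z) + κ * (β + 2 * z))] := by
  ext i
  unfold grad h
  simp (disch := fun_prop) only [pderiv_add, pderiv_sub, pderiv_const, pderiv_mul, pderiv_coord,
    pderiv_sq]
  fin_cases i <;> simp <;> ring

/-- The system is the Nambu system of its two integrals: the field is a multiple of
`∇I₂ × ∇I₁`. The first integrals, the invariant volumes and the Hamiltonian structures are all
consequences of this identity. -/
theorem field_eq_cross (P : Params) (ha₀ : P.a ≠ 0) (ha₁ : P.a ≠ 1) (hκ : P.κ ≠ 0) {p : C3}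
    (hp : p ∈ U₁) :
    field P p = (hamConst P / 6 * p 0) • (grad (I₂ P) p ⨯₃ grad (I₁ P) p) := by
  have hx : p 0 ≠ 0 := hp
  have ha : P.a - 1 ≠ 0 := sub_ne_zero.mpr ha₁
  have g := fun i => grad_I₂ P hp i
  change ∀ i, grad (I₂ P) p i = (grad (h P) p i * p 0 - _) / _ at g
  -- `κ` is kept as an atom, so that `field_simp` can use `hκ`, and `β` is eliminated instead
  have hB : P.β = P.κ - (P.α + P.γ + 2 * P.n) := by rw [Params.κ]; ring
  rw [crossProduct, grad_I₁]
  ext i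
  simp only [grad_h] at g
  fin_cases i
  · simp [g, field, fieldX, hamConst]
    field_simp
    generalize P.κ = k at *
    rw [hB]
    ring
  · simp [g, field, fieldY, hamConst, h]
    field_simp
    generalize P.κ = k at *
    rw [hB]
    ring
  · simp [g, field, fieldY, hamConst, h]
    field_simp
    generalize P.κ = k at *
    rw [hB]
    ring

/-- The divergence of `φ ∇f × ∇g` is `∇φ · (∇f × ∇g)`, since `∇f × ∇g` is divergence-free. -/
theorem sum_pderiv_mul_cross {φ f g : C3 → ℂ} {p : C3} (hφ : DifferentiableAt ℂ φ p)
    (hf : ContDiffAt ℂ 2 f p) (hg : ContDiffAt ℂ 2 g p)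
    (h0 : grad φ p ⬝ᵥ (grad f p ⨯₃ grad g p) = 0) :
    ∑ i, pderiv i (fun q => φ q * (grad f q ⨯₃ grad g q) i) p = 0 := by
  have hdf := fun k => hf.differentiableAt_pderiv k
  have hdg := fun k => hg.differentiableAt_pderiv k
  have hcr : ∀ i, DifferentiableAt ℂ (fun q => (grad f q ⨯₃ grad g q) i) p := by
    intro i
    fin_cases i <;> simp [crossProduct, grad] <;>
      exact ((hdf _).mul (hdg _)).sub ((hdf _).mul (hdg _))
  have key : ∀ l i j,
      pderiv l (fun q => pderiv i f q * pderiv j g q - pderiv j f q * pderiv i g q) p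
      = (pderiv i f p * pderiv l (pderiv j g) p + pderiv j g p * pderiv l (pderiv i f) p)
        - (pderiv j f p * pderiv l (pderiv i g) p + pderiv i g p * pderiv l (pderiv j f) p) := by
    intro l i j
    rw [pderiv_sub l ((hdf _).fun_mul (hdg _)) ((hdf _).fun_mul (hdg _)),
      pderiv_mul l (hdf _) (hdg _), pderiv_mul l (hdf _) (hdg _)]
  simp only [fun i => pderiv_mul i hφ (hcr i)]
  rw [Finset.sum_add_distrib, ← Finset.mul_sum]
  have hdiv : ∑ i, pderiv i (fun q => (grad f q ⨯₃ grad g q) i) p = 0 := by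
    simp only [Fin.sum_univ_three, crossProduct, grad, LinearMap.mk₂_apply, Matrix.cons_val]
    simp only [key, pderiv_comm hf 0 1, pderiv_comm hf 0 2, pderiv_comm hf 1 2,
      pderiv_comm hg 0 1, pderiv_comm hg 0 2, pderiv_comm hg 1 2]
    ring
  rw [hdiv, mul_zero, zero_add]
  simpa [dotProduct, mul_comm, grad] using h0

theorem linearIndependent_fderiv_of_cross_ne_zero {f g : C3 → ℂ} {p : C3}
    (h : grad g p ⨯₃ grad f p ≠ 0) :
    LinearIndependent ℂ ![fderiv ℂ f p, fderiv ℂ g p] := by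
  rw [LinearIndependent.pair_iff]
  intro s t hst
  have hv : s • grad f p + t • grad g p = 0 := by
    ext i
    simpa [grad, pderiv] using DFunLike.congr_fun hst (Pi.single i 1)
  have h1 : t • (grad g p ⨯₃ grad f p) = 0 := by
    have := congrArg (fun v => v ⨯₃ grad f p) hv
    simpa [cross_self] using this
  have h2 : s • (grad g p ⨯₃ grad f p) = 0 := by
    have := congrArg (fun v => grad g p ⨯₃ v) hv
    simpa [cross_self] using this
  exact ⟨(smul_eq_zero.mp h2).resolve_right h, (smul_eq_zero.mp h1).resolve_right h⟩

/-! ### The level curves as plane cubics -/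

/-- The plane cubic `Z² + (-b x² + e x + f) Z + q x² + s x` in the coordinates `x` and `Z = κ z`.
On the plane `I₁ = c` the level set `I₂ = d` is its zero set, with `b = a - 1`, `f = κ β` and `e`,
`q`, `s` given by `fibE`, `fibQ`, `fibM`, see `mem_levelCurve_iff`. -/
def fibreCubic (b e f q s x Z : ℂ) : ℂ :=
  Z ^ 2 + (-b * x ^ 2 + e * x + f) * Z + (q * x ^ 2 + s * x)

/-- The coefficient of `x Z` in the cubic equation of the level curves in the plane `I₁ = c`. -/
def fibE (P : Params) (c : ℂ) : ℂ :=
  (P.a - 1) * P.κ - 2 * c - (P.a * P.γ + 2 * P.a * P.n + P.β)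

/-- The coefficient of `x²` in the cubic equation of the level curves in the plane `I₁ = c`. -/
def fibQ (P : Params) (c : ℂ) : ℂ :=
  c * (P.a * P.γ + 2 * P.a * P.n - P.α - P.γ - 2 * P.n + c)
    + (P.a - 1) * P.a * P.n * (P.γ + P.n)

/-- The coefficient of `x` in the cubic equation of the level curve `I₁ = c`, `I₂ = 0`. On the
level curve `I₂ = d` the coefficient is `fibM P c - d`. -/
def fibM (P : Params) (c : ℂ) : ℂ :=
  P.κ * (c * (P.κ - P.β) + P.a * P.n * (P.γ + P.n))

theorem h_eq (P : Params) (p : C3) :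
    h P p = fibreCubic (P.a - 1) (fibE P (I₁ P p)) (P.κ * P.β) (fibQ P (I₁ P p))
      (fibM P (I₁ P p)) (p 0) (P.κ * p 2) := by
  simp only [h, fibreCubic, fibE, fibQ, fibM, I₁, Params.κ]
  ring

/-- The two expressions in `h0` are the partial derivatives of the cubic of the level curve
through `p`, up to non-zero factors two of the components of `∇I₂ × ∇I₁`. -/
theorem cross_ne_zero_of_fibreCubic_smooth {P : Params} {p : C3} (ha₀ : P.a ≠ 0)
    (ha₁ : P.a ≠ 1) (hκ : P.κ ≠ 0) (hp : p ∈ U₁)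
    (h0 : 2 * (P.κ * p 2) + (-(P.a - 1) * p 0 ^ 2 + fibE P (I₁ P p) * p 0 + P.κ * P.β) ≠ 0 ∨
      P.κ * p 2 * (-2 * (P.a - 1) * p 0 + fibE P (I₁ P p)) + 2 * fibQ P (I₁ P p) * p 0
        + (fibM P (I₁ P p) - I₂ P p) ≠ 0) :
    grad (I₂ P) p ⨯₃ grad (I₁ P) p ≠ 0 := by
  intro hc
  have hx : p 0 ≠ 0 := hp
  have ha : P.a - 1 ≠ 0 := sub_ne_zero.mpr ha₁
  have g := fun i => grad_I₂ P hp i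
  change ∀ i, grad (I₂ P) p i = (grad (h P) p i * p 0 - _) / _ at g
  have hB : P.β = P.κ - (P.α + P.γ + 2 * P.n) := by rw [Params.κ]; ring
  rw [crossProduct, grad_I₁] at hc
  have e0 := congrFun hc 0
  have e1 := congrFun hc 1
  have hI2 : I₂ P p * p 0 = h P p := div_mul_cancel₀ _ hx
  simp only [grad_h] at g
  simp [g] at e0 e1
  rcases h0 with h0 | h0 <;> apply h0
  · field_simp at e0
    have : P.a * P.κ ≠ 0 := mul_ne_zero ha₀ hκ
    apply (mul_eq_zero.mp _).resolve_left this
    simp only [fibE, I₁] at *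
    generalize P.κ = k at *
    rw [hB] at *
    linear_combination -e0
  · have e1 := (e1.resolve_right (sub_ne_zero.mpr ha₁.symm)).resolve_right hx
    apply (mul_eq_zero.mp _).resolve_right hx
    rw [h_eq] at e1 hI2
    simp only [fibreCubic, fibE, I₁, fibQ, fibM] at *
    generalize P.κ = k at *
    rw [hB] at *
    linear_combination e1 - hI2

/-- On each line parallel to the `x`-axis the differentials can be dependent only at `x = 0` and at
the zeros of a polynomial of degree two in `x`. -/
theorem functionallyIndependent (P : Params) (ha₀ : P.a ≠ 0) (ha₁ : P.a ≠ 1) (hκ : P.κ ≠ 0) :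
    FunctionallyIndependent U₁ (I₁ P) (I₂ P) := by
  have ha : P.a - 1 ≠ 0 := sub_ne_zero.mpr ha₁
  intro p hp
  let R : Polynomial ℂ := Polynomial.C (-(P.a - 1)) * Polynomial.X ^ 2 +
    Polynomial.C (fibE P (I₁ P p)) * Polynomial.X
    + Polynomial.C (2 * (P.κ * p 2) + P.κ * P.β)
  have hR : R * Polynomial.X ≠ 0 := by
    refine mul_ne_zero (fun h => ?_) Polynomial.X_ne_zero
    have := Polynomial.natDegree_quadratic (neg_ne_zero.mpr ha) (b := fibE P (I₁ P p))
      (c := 2 * (P.κ * p 2) + P.κ * P.β)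
    change R.natDegree = 2 at this
    simp [h] at this
  have hfin : ({x | (R * Polynomial.X).IsRoot x} : Set ℂ).Finite :=
    Polynomial.finite_setOfPred_isRoot hR
  have hd : p 0 ∈ closure ({x | (R * Polynomial.X).IsRoot x} : Set ℂ)ᶜ :=
    (hfin.countable.dense_compl ℂ) _
  have hcont : Continuous fun x : ℂ => Function.update p 0 x := by fun_prop
  have := map_mem_closure hcont hd
    (t := {p ∈ U₁ | LinearIndependent ℂ ![fderiv ℂ (I₁ P) p, fderiv ℂ (I₂ P) p]}) ?_
  · simpa using this
  intro x hx
  simp only [Set.mem_compl_iff, Set.mem_ofPred_eq, Polynomial.IsRoot, Polynomial.eval_mul, R,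
    Polynomial.eval_X, mul_eq_zero, not_or] at hx
  have hU : Function.update p 0 x ∈ U₁ := by simpa [U₁] using hx.2
  refine ⟨hU, linearIndependent_fderiv_of_cross_ne_zero
    (cross_ne_zero_of_fibreCubic_smooth ha₀ ha₁ hκ hU (Or.inl fun h => hx.1 ?_))⟩
  have hI : I₁ P (Function.update p 0 x) = I₁ P p := by simp [I₁]
  rw [hI] at h
  simp at h ⊢
  linear_combination h

/-! ### First integrals, invariant volumes and Hamiltonian structures -/

theorem differentiableAt_I₂ (P : Params) {p : C3} (hp : p ∈ U₁) : DifferentiableAt ℂ (I₂ P) p :=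
  (contDiffAt_I₂ P hp).differentiableAt (by norm_num)

theorem differentiable_I₁ (P : Params) : Differentiable ℂ (I₁ P) :=
  (contDiff_I₁ P).differentiable (by norm_num)

theorem isFirstIntegral_I₁ (P : Params) (ha₀ : P.a ≠ 0) (ha₁ : P.a ≠ 1) (hκ : P.κ ≠ 0) :
    IsFirstIntegral (field P) U₁ (I₁ P) := by
  refine ⟨(differentiable_I₁ P).differentiableOn, fun p hp => ?_⟩
  rw [fderiv_eq_grad, field_eq_cross P ha₀ ha₁ hκ hp, dotProduct_smul, dot_cross_self, smul_zero]

theorem isFirstIntegral_I₂ (P : Params) (ha₀ : P.a ≠ 0) (ha₁ : P.a ≠ 1) (hκ : P.κ ≠ 0) :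
    IsFirstIntegral (field P) U₁ (I₂ P) := by
  refine ⟨fun p hp => (differentiableAt_I₂ P hp).differentiableWithinAt, fun p hp => ?_⟩
  rw [fderiv_eq_grad, field_eq_cross P ha₀ ha₁ hκ hp, dotProduct_smul, dot_self_cross, smul_zero]

theorem pderiv_congr {f g : C3 → ℂ} {U : Set C3} (hU : IsOpen U) (h : Set.EqOn f g U) {p : C3}
    (hp : p ∈ U) (i : Fin 3) : pderiv i f p = pderiv i g p := by
  rw [pderiv, (h.eventuallyEq_of_mem (hU.mem_nhds hp)).fderiv_eq, pderiv]

theorem differentiableAt_w₁ {p : C3} (hp : p ∈ U₁) : DifferentiableAt ℂ w₁ p :=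
  differentiableAt_div (differentiableAt_const 1) (differentiableAt_apply 0 p) hp

theorem differentiableAt_w₂ {P : Params} {p : C3} (hp : p ∈ U₂ P) :
    DifferentiableAt ℂ (w₂ P) p :=
  differentiableAt_div (differentiableAt_const 1) (differentiable_h P p) hp.2

theorem preservesVolume_w₁ (P : Params) (ha₀ : P.a ≠ 0) (ha₁ : P.a ≠ 1) (hκ : P.κ ≠ 0) :
    PreservesVolume (field P) U₁ w₁ := by
  refine ⟨fun p hp => ?_, fun p hp => one_div_ne_zero hp, fun p hp => ?_⟩
  · exact (differentiableAt_w₁ hp).differentiableWithinAt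
  · have hEq : ∀ i, Set.EqOn (fun q => w₁ q * field P q i)
        (fun q => hamConst P / 6 * (grad (I₂ P) q ⨯₃ grad (I₁ P) q) i) U₁ := by
      intro i q hq
      have : q 0 ≠ 0 := hq
      simp only [field_eq_cross P ha₀ ha₁ hκ hq, w₁, Pi.smul_apply, smul_eq_mul]
      field_simp
    simp only [fun i => pderiv_congr isOpen_U₁ (hEq i) hp i]
    refine sum_pderiv_mul_cross (differentiableAt_const _) (contDiffAt_I₂ P hp)
      (contDiff_I₁ P).contDiffAt ?_
    have : grad (fun _ => hamConst P / 6) p = 0 := by ext i; exact pderiv_const i _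
    rw [this, zero_dotProduct]

theorem I₂_ne_zero {P : Params} {p : C3} (hp : p ∈ U₂ P) : I₂ P p ≠ 0 :=
  div_ne_zero hp.2 hp.1

theorem grad_const_div_I₂ {P : Params} {p : C3} (c : ℂ) (hp : p ∈ U₂ P) :
    grad (fun q => c / I₂ P q) p = (-c / I₂ P p ^ 2) • grad (I₂ P) p := by
  ext i
  rw [grad, pderiv_div i (differentiableAt_const c)
        (differentiableAt_I₂ P hp.1) (I₂_ne_zero hp), pderiv_const]
  simp [grad]
  ring

theorem preservesVolume_w₂ (P : Params) (ha₀ : P.a ≠ 0) (ha₁ : P.a ≠ 1) (hκ : P.κ ≠ 0) :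
    PreservesVolume (field P) (U₂ P) (w₂ P) := by
  refine ⟨fun p hp => ?_, fun p hp => one_div_ne_zero hp.2, fun p hp => ?_⟩
  · exact (differentiableAt_w₂ hp).differentiableWithinAt
  · have hEq : ∀ i, Set.EqOn (fun q => w₂ P q * field P q i)
        (fun q => hamConst P / 6 / I₂ P q * (grad (I₂ P) q ⨯₃ grad (I₁ P) q) i) (U₂ P) := by
      intro i q hq
      have h0 : q 0 ≠ 0 := hq.1
      have hh := hq.2
      simp only [field_eq_cross P ha₀ ha₁ hκ hq.1, w₂, Pi.smul_apply, smul_eq_mul, I₂]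
      field_simp
    simp only [fun i => pderiv_congr (isOpen_U₂ P) (hEq i) hp i]
    refine sum_pderiv_mul_cross
      (differentiableAt_div (differentiableAt_const (hamConst P / 6)) (differentiableAt_I₂ P hp.1)
        (I₂_ne_zero hp))
      (contDiffAt_I₂ P hp.1) (contDiff_I₁ P).contDiffAt ?_
    rw [grad_const_div_I₂ _ hp, smul_dotProduct, dot_self_cross, smul_zero]

theorem isPoissonPair_w₁ (P : Params) :
    IsPoissonPair U₁ (contractedTensor w₁ (I₁ P)) (contractedTensor w₁ (I₂ P)) :=
  isPoissonPair_contractedTensor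
    (fun _ hp => differentiableAt_w₁ hp)
    (fun _ hp => one_div_ne_zero hp) (fun _ _ => (contDiff_I₁ P).contDiffAt)
    (fun _ hp => contDiffAt_I₂ P hp) isOpen_U₁

theorem isPoissonPair_w₂ (P : Params) :
    IsPoissonPair (U₂ P) (contractedTensor (w₂ P) (I₁ P)) (contractedTensor (w₂ P) (I₂ P)) :=
  isPoissonPair_contractedTensor
    (fun _ hp => differentiableAt_w₂ hp)
    (fun _ hp => one_div_ne_zero hp.2) (fun _ _ => (contDiff_I₁ P).contDiffAt)
    (fun _ hp => contDiffAt_I₂ P hp.1) (isOpen_U₂ P)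

theorem grad_const_mul {f : C3 → ℂ} {p : C3} (c : ℂ) (hf : DifferentiableAt ℂ f p) :
    grad (fun q => c * f q) p = c • grad f p := by
  ext i; exact pderiv_const_mul i c hf

theorem isHamiltonianOn_w₁_I₁ (P : Params) (ha₀ : P.a ≠ 0) (ha₁ : P.a ≠ 1) (hκ : P.κ ≠ 0) :
    IsHamiltonianOn (field P) U₁ (contractedTensor w₁ (I₁ P)) (fun p => hamConst P * I₂ P p) := by
  refine ⟨fun p hp => ((differentiableAt_I₂ P hp).const_mul _).differentiableWithinAt,
    fun p hp => ?_⟩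
  rw [contractedTensor_mulVec, grad_const_mul _ (differentiableAt_I₂ P hp),
    field_eq_cross P ha₀ ha₁ hκ hp, map_smul, LinearMap.smul_apply, smul_smul]
  congr 1
  simp [w₁]
  ring

theorem isHamiltonianOn_w₁_I₂ (P : Params) (ha₀ : P.a ≠ 0) (ha₁ : P.a ≠ 1) (hκ : P.κ ≠ 0) :
    IsHamiltonianOn (field P) U₁ (contractedTensor w₁ (I₂ P))
      (fun p => -hamConst P * I₁ P p) := by
  refine ⟨((differentiable_I₁ P).const_mul _).differentiableOn, fun p hp => ?_⟩
  rw [contractedTensor_mulVec, grad_const_mul _ (differentiable_I₁ P p),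
    field_eq_cross P ha₀ ha₁ hκ hp, map_smul, LinearMap.smul_apply, smul_smul,
    ← cross_anticomm, ← neg_smul_neg, neg_neg]
  congr 1
  simp [w₁]
  ring

theorem isHamiltonianOn_w₂_I₁ (P : Params) (ha₀ : P.a ≠ 0) (ha₁ : P.a ≠ 1) (hκ : P.κ ≠ 0)
    {V : Set C3} (hV : IsOpen V) (hVU : V ⊆ U₂ P) {Λ : C3 → ℂ} (hΛ : DifferentiableOn ℂ Λ V)
    (hexp : ∀ q ∈ V, Complex.exp (Λ q) = I₂ P q) :
    IsHamiltonianOn (field P) V (contractedTensor (w₂ P) (I₁ P)) (fun q => hamConst P * Λ q) := by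
  refine ⟨hΛ.const_mul _, fun p hp => ?_⟩
  have hp2 := hVU hp
  have hd : DifferentiableAt ℂ Λ p := hΛ.differentiableAt (hV.mem_nhds hp)
  have hg : grad Λ p = (1 / I₂ P p) • grad (I₂ P) p := by
    ext i
    have h1 := pderiv_congr hV hexp hp i
    have h2 : pderiv i (fun q => Complex.exp (Λ q)) p = Complex.exp (Λ p) * pderiv i Λ p := by
      rw [pderiv, hd.hasFDerivAt.cexp.fderiv]
      simp [pderiv]
    rw [h2, hexp p hp] at h1
    have := I₂_ne_zero hp2
    simp only [grad, Pi.smul_apply, smul_eq_mul]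
    change pderiv i Λ p = 1 / I₂ P p * pderiv i (I₂ P) p
    rw [← show _ = pderiv i (I₂ P) p from h1]
    field_simp
  rw [contractedTensor_mulVec, grad_const_mul _ hd, hg,
    field_eq_cross P ha₀ ha₁ hκ hp2.1, map_smul, map_smul, LinearMap.smul_apply,
    LinearMap.smul_apply, smul_smul, smul_smul]
  congr 1
  have := hp2.1
  have := hp2.2
  simp [w₂, I₂]
  field_simp

/-- Near a point `p` the function `log (I₂ / I₂ p) + log (I₂ p)`, with principal values, is a
holomorphic logarithm of `I₂`, since the argument of its first term is close to `1`. -/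
theorem exists_log_branch (P : Params) {p : C3} (hp : p ∈ U₂ P) :
    ∃ V : Set C3, IsOpen V ∧ p ∈ V ∧ V ⊆ U₂ P ∧
      ∃ Λ : C3 → ℂ, DifferentiableOn ℂ Λ V ∧ ∀ q ∈ V, Complex.exp (Λ q) = I₂ P q := by
  have h0 := I₂_ne_zero hp
  have hd : DifferentiableOn ℂ (fun q => I₂ P q / I₂ P p) (U₂ P) := fun q hq =>
    (differentiableAt_div (differentiableAt_I₂ P hq.1)
      (differentiableAt_const _) h0).differentiableWithinAt
  refine ⟨U₂ P ∩ (fun q => I₂ P q / I₂ P p) ⁻¹' Complex.slitPlane,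
    hd.continuousOn.isOpen_inter_preimage (isOpen_U₂ P) Complex.isOpen_slitPlane,
    ⟨hp, by simp [h0]⟩, Set.inter_subset_left,
    fun q => Complex.log (I₂ P q / I₂ P p) + Complex.log (I₂ P p), ?_, ?_⟩
  · exact ((hd.mono Set.inter_subset_left).clog fun q hq => hq.2).add_const _
  · intro q hq
    rw [Complex.exp_add, Complex.exp_log (div_ne_zero (I₂_ne_zero hq.1) h0), Complex.exp_log h0,
      div_mul_cancel₀ _ h0]

theorem isHamiltonianOn_w₂_I₂ (P : Params) (ha₀ : P.a ≠ 0) (ha₁ : P.a ≠ 1) (hκ : P.κ ≠ 0) :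
    IsHamiltonianOn (field P) (U₂ P) (contractedTensor (w₂ P) (I₂ P))
      (fun p => -hamConst P * (I₁ P p / I₂ P p)) := by
  have hq : ∀ p ∈ U₂ P, DifferentiableAt ℂ (fun q => I₁ P q / I₂ P q) p := fun p hp =>
    differentiableAt_div (differentiable_I₁ P p) (differentiableAt_I₂ P hp.1) (I₂_ne_zero hp)
  refine ⟨fun p hp => ((hq p hp).const_mul _).differentiableWithinAt, fun p hp => ?_⟩
  have hg : grad (fun q => I₁ P q / I₂ P q) p
      = (1 / I₂ P p) • grad (I₁ P) p + (-I₁ P p / I₂ P p ^ 2) • grad (I₂ P) p := by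
    ext i
    have := I₂_ne_zero hp
    rw [grad, pderiv_div i (differentiable_I₁ P p) (differentiableAt_I₂ P hp.1) (I₂_ne_zero hp)]
    simp only [Pi.add_apply, Pi.smul_apply, smul_eq_mul, grad]
    field_simp
    ring
  rw [contractedTensor_mulVec, grad_const_mul _ (hq p hp), hg, field_eq_cross P ha₀ ha₁ hκ hp.1,
    map_smul, LinearMap.smul_apply, map_add, LinearMap.add_apply, map_smul, map_smul,
    LinearMap.smul_apply, LinearMap.smul_apply, cross_self, smul_zero, add_zero, smul_smul,
    smul_smul, ← cross_anticomm, ← neg_smul_neg, neg_neg]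
  congr 1
  have := hp.1
  have := hp.2
  simp [w₂, I₂]
  field_simp

/-! ### Plane curves of degree two over a line -/

/-- A polynomial that vanishes at the points of a curve `y² + A(x) y + B(x) = 0` lying over almost
all `x` is divisible by the equation of the curve: its remainder is `r₁(x) y + r₀(x)`, and over
almost all `x` the curve has two points, which forces `r₁(x) = r₀(x) = 0`. -/
theorem quadratic_dvd_of_evalEval_eq_zero {A B d : ℂ[X]} (hdisc : A ^ 2 - 4 * B ≠ 0) (hd : d ≠ 0)
    {F : ℂ[X][X]}
    (hF : ∀ x y, d.eval x ≠ 0 → y ^ 2 + A.eval x * y + B.eval x = 0 → F.evalEval x y = 0) :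
    (X ^ 2 + C A * X + C B : ℂ[X][X]) ∣ F := by
  set G : ℂ[X][X] := X ^ 2 + C A * X + C B with hG
  have hdeg : (C A * X + C B : ℂ[X][X]).degree < 2 := degree_linear_lt
  have hmonic : G.Monic := by
    rw [hG, add_assoc]
    exact monic_X_pow_add hdeg
  have hGdeg : G.degree = 2 := by
    rw [hG, add_assoc, degree_add_eq_left_of_degree_lt] <;> simp [hdeg]
  set r := F %ₘ G with hr
  have hrdeg : r.degree ≤ 1 := by
    have h := degree_modByMonic_lt F hmonic
    rw [hGdeg] at h
    exact Order.le_of_lt_succ h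
  have hr' := eq_X_add_C_of_degree_le_one hrdeg
  have hev : ∀ x y, d.eval x ≠ 0 → y ^ 2 + A.eval x * y + B.eval x = 0 →
      (r.coeff 1).eval x * y + (r.coeff 0).eval x = 0 := by
    intro x y hx hy
    have h1 := hF x y hx hy
    rw [← modByMonic_add_div F G, evalEval_add, evalEval_mul, ← hr, hr', hG] at h1
    simpa [evalEval, hy] using h1
  have hroots : ∀ x, d.eval x ≠ 0 → (A ^ 2 - 4 * B).eval x ≠ 0 →
      (r.coeff 1).eval x = 0 ∧ (r.coeff 0).eval x = 0 := by
    intro x hx hD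
    obtain ⟨δ, hδ⟩ := IsAlgClosed.exists_pow_nat_eq ((A ^ 2 - 4 * B).eval x) (n := 2) two_pos
    have hδ0 : δ ≠ 0 := by
      rintro rfl; exact hD (by simpa using hδ.symm)
    have hδ' : δ ^ 2 = A.eval x ^ 2 - 4 * B.eval x := by simpa using hδ
    have e1 := hev x ((-A.eval x + δ) / 2) hx (by linear_combination hδ' / 4)
    have e2 := hev x ((-A.eval x - δ) / 2) hx (by linear_combination hδ' / 4)
    have h1 : (r.coeff 1).eval x = 0 :=
      (mul_eq_zero.mp (by linear_combination e1 - e2 : (r.coeff 1).eval x * δ = 0)).resolve_right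
        hδ0
    exact ⟨h1, by simpa [h1] using e1⟩
  -- multiplying by `d` and the discriminant discards the exceptional `x`
  have hzero : ∀ c : ℂ[X], (∀ x, d.eval x ≠ 0 → (A ^ 2 - 4 * B).eval x ≠ 0 → c.eval x = 0) →
      c = 0 := by
    intro c hc
    have : c * (d * (A ^ 2 - 4 * B)) = 0 := by
      apply Polynomial.funext
      intro x
      rw [eval_mul, eval_mul, eval_zero]
      by_cases h1 : d.eval x = 0
      · simp [h1]
      by_cases h2 : (A ^ 2 - 4 * B).eval x = 0
      · rw [h2]; simp
      rw [hc x h1 h2, zero_mul]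
    exact (mul_eq_zero.mp this).resolve_right (mul_ne_zero hd hdisc)
  rw [← modByMonic_eq_zero_iff_dvd hmonic, ← hr, hr', hzero _ fun x h1 h2 => (hroots x h1 h2).1,
    hzero _ fun x h1 h2 => (hroots x h1 h2).2]
  simp

/-- A polynomial that vanishes at almost all points of a Weierstrass curve is divisible by its
equation. -/
theorem weierstrass_dvd_of_evalEval_eq_zero {W : WeierstrassCurve.Affine ℂ} {d : ℂ[X]} (hd : d ≠ 0)
    {F : ℂ[X][X]} (hF : ∀ x y, d.eval x ≠ 0 → W.Equation x y → F.evalEval x y = 0) :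
    W.polynomial ∣ F := by
  have hW : W.polynomial = X ^ 2 + C (C W.a₁ * X + C W.a₃) * X
      + C (-(X ^ 3 + C W.a₂ * X ^ 2 + C W.a₄ * X + C W.a₆)) := by
    simp [WeierstrassCurve.Affine.polynomial]
    ring
  rw [hW]
  refine quadratic_dvd_of_evalEval_eq_zero (d := d) ?_ hd fun x y hx hxy => hF x y hx ?_
  · intro h0
    have hx := fun x => congrArg (eval x) h0
    simp only [eval_add, eval_sub, eval_neg, eval_mul, eval_pow, eval_ofNat, eval_C, eval_X,
      eval_zero] at hx
    -- the third difference of a cubic with leading coefficient `4`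
    have : (24 : ℂ) = 0 := by linear_combination hx 3 - 3 * hx 2 + 3 * hx 1 - hx 0
    norm_num at this
  · simp only [eval_add, eval_neg, eval_mul, eval_pow, eval_C, eval_X] at hxy
    rw [WeierstrassCurve.Affine.equation_iff']
    linear_combination hxy

/-- A polynomial that vanishes at almost all points of the cubic vanishes at all of them. -/
theorem evalEval_eq_zero_of_fibreCubic {b e f q s : ℂ} (hb : b ≠ 0) {d : ℂ[X]} (hd : d ≠ 0)
    {F : ℂ[X][X]}
    (hF : ∀ x Z, d.eval x ≠ 0 → fibreCubic b e f q s x Z = 0 → F.evalEval x Z = 0) {x Z : ℂ}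
    (h : fibreCubic b e f q s x Z = 0) : F.evalEval x Z = 0 := by
  have hdvd : X ^ 2 + C (C (-b) * X ^ 2 + C e * X + C f) * X + C (C q * X ^ 2 + C s * X) ∣ F := by
    refine quadratic_dvd_of_evalEval_eq_zero (d := d) ?_ hd fun x Z hx hxZ => hF x Z hx ?_
    · intro h0
      have hx := fun x => congrArg (eval x) h0
      simp only [eval_add, eval_sub, eval_mul, eval_pow, eval_ofNat, eval_C, eval_X,
        eval_zero] at hx
      -- the fourth difference of a quartic with leading coefficient `b ^ 2`
      have : 24 * b ^ 2 = 0 := by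
        linear_combination hx 4 - 4 * hx 3 + 6 * hx 2 - 4 * hx 1 + hx 0
      simp [hb] at this
    · simp only [eval_add, eval_mul, eval_pow, eval_X, eval_C] at hxZ
      unfold fibreCubic
      linear_combination hxZ
  obtain ⟨H, rfl⟩ := hdvd
  rw [evalEval_mul]
  apply mul_eq_zero_of_left
  rw [← h]
  simp [evalEval, fibreCubic]

/-! ### The Weierstrass model of the level curves -/

/-- The Weierstrass curve `Y² + e X Y + s b Y = X (X + b f) (X - q)`, birational to the cubic
`fibreCubic b e f q s` by `X = b Z`, `Y = b x (q - b Z)`. -/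
def fibreWeierstrass {R : Type*} [CommRing R] (b e f q s : R) : WeierstrassCurve R :=
  ⟨e, b * f - q, s * b, -(q * f * b), 0⟩

section
variable {b e f q s : ℂ}

theorem equation_fibreWeierstrass_iff (X Y : ℂ) :
    (fibreWeierstrass b e f q s).toAffine.Equation X Y ↔
      Y ^ 2 + e * X * Y + s * b * Y = X * (X + b * f) * (X - q) := by
  rw [WeierstrassCurve.Affine.equation_iff]
  simp only [fibreWeierstrass]
  constructor <;> intro h <;> linear_combination h

theorem equation_of_fibreCubic {x Z : ℂ} (h : fibreCubic b e f q s x Z = 0) :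
    (fibreWeierstrass b e f q s).toAffine.Equation (b * Z) (b * x * (q - b * Z)) := by
  rw [equation_fibreWeierstrass_iff]
  unfold fibreCubic at h
  linear_combination b ^ 2 * (q - b * Z) * h

theorem fibreCubic_of_equation (hb : b ≠ 0) {X Y : ℂ} (hX : q - X ≠ 0)
    (h : (fibreWeierstrass b e f q s).toAffine.Equation X Y) :
    fibreCubic b e f q s (Y / (b * (q - X))) (X / b) = 0 := by
  rw [equation_fibreWeierstrass_iff] at h
  unfold fibreCubic
  field_simp
  linear_combination (q - X) * h

theorem no_singular_point (hΔ : (fibreWeierstrass b e f q s).Δ ≠ 0) {X Y : ℂ}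
    (h : (fibreWeierstrass b e f q s).toAffine.Equation X Y)
    (hX : e * Y = 3 * X ^ 2 + 2 * (b * f - q) * X - q * f * b)
    (hY : 2 * Y + e * X + s * b = 0) : False := by
  have := (WeierstrassCurve.Affine.equation_iff_nonsingular_of_Δ_ne_zero hΔ).mp h
  rw [WeierstrassCurve.Affine.nonsingular_iff'] at this
  simp only [fibreWeierstrass] at this
  rcases this.2 with h' | h' <;> apply h'
  · linear_combination hX
  · linear_combination hY

/-- The map to the Weierstrass model carries singular points to singular points, also where it
is not locally invertible. -/
theorem fibreCubic_smooth (hΔ : (fibreWeierstrass b e f q s).Δ ≠ 0) {x Z : ℂ}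
    (h : fibreCubic b e f q s x Z = 0) :
    2 * Z + (-b * x ^ 2 + e * x + f) ≠ 0 ∨ Z * (-2 * b * x + e) + 2 * q * x + s ≠ 0 := by
  by_contra! hc
  refine no_singular_point hΔ (equation_of_fibreCubic h) ?_ ?_
  · unfold fibreCubic at h
    linear_combination b * (-b * h + (q - b * Z) * hc.1 + b * x * hc.2)
  · linear_combination b * hc.2

/-- Clearing denominators in `F(num / D)`, uniformly in the field in which the two variables of
`num` and `D` are evaluated: the function field and `ℂ` itself are the two cases of use. -/
theorem exists_clear_denominators {σ : Type*} (D : ℂ[X][X]) (num : σ → ℂ[X][X])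
    (F : MvPolynomial σ ℂ) :
    ∃ (N : ℕ) (F' : ℂ[X][X]), ∀ (L : Type) [Field L] [Algebra ℂ L] (u v : L),
      aevalAeval u v D ≠ 0 →
      MvPolynomial.aeval (fun i => aevalAeval u v (num i) / aevalAeval u v D) F
        * aevalAeval u v D ^ N = aevalAeval u v F' := by
  induction F using MvPolynomial.induction_on with
  | C c => exact ⟨0, C (C c), by intros; simp⟩
  | add F H hF hH =>
    obtain ⟨N, F', hF⟩ := hF
    obtain ⟨M, H', hH⟩ := hH
    refine ⟨N + M, F' * D ^ M + H' * D ^ N, fun L _ _ u v hD => ?_⟩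
    rw [map_add, map_add, map_mul, map_mul, ← hF L u v hD, ← hH L u v hD, map_pow, map_pow]
    ring
  | mul_X F i hF =>
    obtain ⟨N, F', hF⟩ := hF
    refine ⟨N + 1, F' * num i, fun L _ _ u v hD => ?_⟩
    rw [map_mul, map_mul, ← hF L u v hD, pow_succ, MvPolynomial.aeval_X]
    field_simp

/-- To see that `V` is birationally elliptic it suffices to parametrise its generic point by
functions on an elliptic curve `W`, in such a way that the coordinate functions of `W` are
polynomials in the parametrising functions. -/
theorem isBirationallyElliptic_of_algHom {V : Set C3} {W : WeierstrassCurve ℂ} (hW : W.IsElliptic)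
    (φ : MvPolynomial (Fin 3) ℂ →ₐ[ℂ] W.toAffine.FunctionField)
    (hker : MvPolynomial.vanishingIdeal ℂ V = RingHom.ker φ)
    (hrange : ∀ r : W.toAffine.CoordinateRing, ∃ F,
      φ F = algebraMap W.toAffine.CoordinateRing W.toAffine.FunctionField r) :
    IsBirationallyElliptic V := by
  let K := W.toAffine.FunctionField
  refine ⟨hker ▸ RingHom.ker_isPrime φ, W, hW, ?_⟩
  let ψ : CoordRing V →ₐ[ℂ] K := Ideal.Quotient.liftₐ _ φ fun F hF => by
    rwa [hker, RingHom.mem_ker] at hF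
  have hψ : Function.Injective ψ := by
    rw [injective_iff_map_eq_zero]
    intro r hr
    obtain ⟨F, rfl⟩ := Ideal.Quotient.mk_surjective r
    rw [Ideal.Quotient.eq_zero_iff_mem, hker]
    exact hr
  let : Algebra (CoordRing V) K := ψ.toRingHom.toAlgebra
  have : IsScalarTower ℂ (CoordRing V) K := IsScalarTower.of_algebraMap_eq' ψ.comp_algebraMap.symm
  have : FaithfulSMul (CoordRing V) K := (faithfulSMul_iff_algebraMap_injective _ _).mpr hψ
  have : IsFractionRing (CoordRing V) K := by
    refine IsFractionRing.of_field _ _ fun z => ?_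
    obtain ⟨r, t, -, rfl⟩ := IsFractionRing.div_surjective W.toAffine.CoordinateRing z
    obtain ⟨F, hF⟩ := hrange r
    obtain ⟨H, hH⟩ := hrange t
    refine ⟨Ideal.Quotient.mk _ F, Ideal.Quotient.mk _ H, ?_⟩
    rw [← hF, ← hH]
    rfl
  exact ⟨(FractionRing.algEquiv (CoordRing V) K).restrictScalars ℂ⟩

/-- A curve given by `fibreCubic` in the plane `y = μ + ν z`, punctured at `x = 0`, is birational
to its Weierstrass model. The substitution `φ` of the inverse map sends a polynomial to zero
exactly when the polynomial vanishes on the curve. -/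
theorem isBirationallyElliptic_of_fibreCubic {κ μ ν : ℂ} (hb : b ≠ 0) (hκ : κ ≠ 0)
    (hΔ : (fibreWeierstrass b e f q s).Δ ≠ 0) {V : Set C3}
    (hV : ∀ p, p ∈ V ↔ p 0 ≠ 0 ∧ p 1 = μ + ν * p 2 ∧ fibreCubic b e f q s (p 0) (κ * p 2) = 0) :
    IsBirationallyElliptic V := by
  set W := fibreWeierstrass b e f q s with hW
  let K := W.toAffine.FunctionField
  let mk := AdjoinRoot.mk W.toAffine.polynomial
  let ι : ℂ[X][X] →ₐ[ℂ] K :=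
    aevalAeval (algebraMap W.toAffine.CoordinateRing K (mk (C X)))
      (algebraMap W.toAffine.CoordinateRing K (mk X))
  have hι : ∀ F, ι F = algebraMap W.toAffine.CoordinateRing K (mk F) := by
    intro F
    have : (ι : ℂ[X][X] →+* K) = (algebraMap W.toAffine.CoordinateRing K).comp mk := by
      refine ringHom_ext' (ringHom_ext (fun z => ?_) ?_) ?_
      · simp only [RingHom.comp_apply, RingHom.coe_coe, ι, aevalAeval_C, aeval_C]
        rfl
      · simp [ι]
      · simp [ι]
    exact DFunLike.congr_fun this F
  have hι0 : ∀ F, ι F = 0 ↔ W.toAffine.polynomial ∣ F := by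
    intro F
    rw [hι, FaithfulSMul.algebraMap_eq_zero_iff, AdjoinRoot.mk_eq_zero]
  -- the inverse `x = Y / (b (q - X))`, `Z = X / b` of the map to `W`, over a common denominator
  let D : ℂ[X][X] := C (C b * (C q - X))
  let num : Fin 3 → ℂ[X][X] := ![X, C ((C μ + C (ν / (b * κ)) * X) * (C b * (C q - X))),
      C (C (b * κ)⁻¹ * X * (C b * (C q - X)))]
  have hqX : (C q - X : ℂ[X]) ≠ 0 := by
    rw [← neg_sub]; exact neg_ne_zero.mpr (X_sub_C_ne_zero q)
  have hD : ι D ≠ 0 := by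
    rw [Ne, hι0]
    refine WeierstrassCurve.Affine.monic_polynomial.not_dvd_of_degree_lt ?_ ?_
    · exact C_ne_zero.mpr (mul_ne_zero (C_ne_zero.mpr hb) hqX)
    · rw [WeierstrassCurve.Affine.degree_polynomial]
      exact degree_C_le.trans_lt (by norm_num)
  let φ : MvPolynomial (Fin 3) ℂ →ₐ[ℂ] K := MvPolynomial.aeval fun i => ι (num i) / ι D
  have hφ : ∀ i, φ (MvPolynomial.X i) = ι (num i) / ι D := fun i => MvPolynomial.aeval_X _ _
  have hker : MvPolynomial.vanishingIdeal ℂ V = RingHom.ker φ := by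
    ext F
    rw [MvPolynomial.mem_vanishingIdeal_iff, RingHom.mem_ker]
    obtain ⟨N, F', hF'⟩ := exists_clear_denominators D num F
    have hφF : φ F = 0 ↔ W.toAffine.polynomial ∣ F' := by
      rw [← hι0, ← hF' K _ _ hD, mul_eq_zero, or_iff_left (pow_ne_zero N hD)]
    have hpt : ∀ u v : ℂ, u ≠ q →
        MvPolynomial.aeval ![v / (b * (q - u)), μ + ν * (u / (b * κ)), u / (b * κ)] F
          * (b * (q - u)) ^ N = F'.evalEval u v := by
      intro u v hu
      have hu' : q - u ≠ 0 := sub_ne_zero.mpr hu.symm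
      have hDe : aevalAeval u v D = b * (q - u) := by simp [D]
      rw [← coe_aevalAeval_eq_evalEval, ← hF' ℂ u v (by rw [hDe]; exact mul_ne_zero hb hu'), hDe]
      congr 3
      ext i
      fin_cases i
      · simp [num]
      · simp [num]
        field_simp
      · simp [num]
        field_simp
    rw [hφF]
    constructor
    -- almost every point of `W` parametrises a point of `V`
    · intro hF
      refine weierstrass_dvd_of_evalEval_eq_zero (d := X * (X + C (b * f)) * (X - C q)) ?_ ?_
      · exact mul_ne_zero (mul_ne_zero X_ne_zero (X_add_C_ne_zero _)) (X_sub_C_ne_zero _)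
      · intro x y hx hEq
        simp only [eval_mul, eval_add, eval_sub, eval_X, eval_C] at hx
        have hxy := hEq
        rw [hW, equation_fibreWeierstrass_iff] at hxy
        have hxq : x ≠ q := fun h => hx (by rw [h]; ring)
        have hy : y ≠ 0 := by
          rintro rfl
          exact hx (by linear_combination -hxy)
        have hq : q - x ≠ 0 := sub_ne_zero.mpr hxq.symm
        rw [← hpt x y hxq, hF _ ((hV _).mpr ⟨?_, ?_, ?_⟩), zero_mul]
        · exact div_ne_zero hy (mul_ne_zero hb hq)
        · simp
        · have := fibreCubic_of_equation hb hq hEq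
          simp only [Matrix.cons_val]
          convert this using 2
          field_simp
    -- almost every point of `V` is parametrised by a point of `W`
    · intro hF p hp
      obtain ⟨h0, h1, h2⟩ := (hV p).mp hp
      let G : ℂ[X][X] := MvPolynomial.aeval ![C X, C (C μ) + C (C (ν / κ)) * X, C (C κ⁻¹) * X] F
      have hG : ∀ x Z, G.evalEval x Z =
          MvPolynomial.aeval ![x, μ + ν / κ * Z, κ⁻¹ * Z] F := by
        intro x Z
        rw [← coe_aevalAeval_eq_evalEval, MvPolynomial.comp_aeval_apply]
        congr 2
        ext i
        fin_cases i <;> simp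
      have hvan : G.evalEval (p 0) (κ * p 2) = 0 := by
        -- over the zeros of `d` lie the points with `b * Z = q`, where the parametrisation
        -- breaks down; if `d` were zero, `(q, 0)` would be a singular point of `W`
        refine evalEval_eq_zero_of_fibreCubic hb
          (d := C (b * (e * q + s * b)) * X + C (q ^ 2 + b * f * q)) ?_ ?_ h2
        · intro h0
          have hx := fun x => congrArg (eval x) h0
          simp only [eval_add, eval_mul, eval_C, eval_X, eval_zero] at hx
          have h1 : b * (e * q + s * b) = 0 := by linear_combination hx 1 - hx 0
          have h2 : q ^ 2 + b * f * q = 0 := by linear_combination hx 0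
          have h3 := (mul_eq_zero.mp h1).resolve_left hb
          refine no_singular_point hΔ (X := q) (Y := 0) ?_ ?_ ?_
          · rw [equation_fibreWeierstrass_iff]; ring
          · linear_combination -h2
          · linear_combination h3
        · intro x Z hx hc
          simp only [eval_mul, eval_add, eval_X, eval_C] at hx
          have hZ : q - b * Z ≠ 0 := by
            intro h
            apply hx
            have hq : q = b * Z := by linear_combination h
            unfold fibreCubic at hc
            rw [hq]
            linear_combination b ^ 2 * hc - b ^ 2 * x ^ 2 * h
          have hE := equation_of_fibreCubic hc
          have hev : F'.evalEval (b * Z) (b * x * (q - b * Z)) = 0 := by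
            obtain ⟨H, rfl⟩ := hF
            rw [evalEval_mul]
            rw [show W.toAffine.polynomial.evalEval _ _ = 0 from hE, zero_mul]
          rw [← hpt _ _ (sub_ne_zero.mp hZ).symm, mul_eq_zero,
            or_iff_left (pow_ne_zero N (mul_ne_zero hb hZ))] at hev
          rw [hG, ← hev]
          congr 2
          ext i
          fin_cases i <;> simp <;> field_simp
      rw [hG] at hvan
      rw [← hvan]
      congr 2
      ext i
      fin_cases i <;> simp [h1] <;> field_simp
  have hrange : ∀ r : W.toAffine.CoordinateRing, ∃ F,
      φ F = algebraMap W.toAffine.CoordinateRing K r := by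
    intro r
    obtain ⟨H, rfl⟩ := AdjoinRoot.mk_surjective r
    let σ : ℂ[X][X] →ₐ[ℂ] MvPolynomial (Fin 3) ℂ :=
      aevalAeval (MvPolynomial.C (b * κ) * MvPolynomial.X 2) (MvPolynomial.C b * MvPolynomial.X 0 *
        (MvPolynomial.C q - MvPolynomial.C (b * κ) * MvPolynomial.X 2))
    refine ⟨σ H, (?_ : _ = _).trans (hι H)⟩
    have hC : ∀ z : ℂ, φ (MvPolynomial.C z) = ι (C (C z)) := by
      intro z
      simp [φ, ι, aeval_C]
    have h2 : φ (MvPolynomial.X 2) = ι (C (C (b * κ)⁻¹ * X)) := by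
      rw [hφ, div_eq_iff hD, ← map_mul]
      simp [num, D]
    have hX : φ (MvPolynomial.C (b * κ) * MvPolynomial.X 2) = ι (C X) := by
      rw [map_mul, hC, h2, ← map_mul, ← C_mul, ← mul_assoc, ← C_mul,
        mul_inv_cancel₀ (mul_ne_zero hb hκ), C_1, one_mul]
    have hY : φ (MvPolynomial.C b * MvPolynomial.X 0 *
        (MvPolynomial.C q - MvPolynomial.C (b * κ) * MvPolynomial.X 2)) = ι X := by
      rw [map_mul, map_sub, hX, hC, map_mul, hC, hφ]
      have : ι D = ι (C (C b)) * (ι (C (C q)) - ι (C X)) := by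
        rw [← map_sub, ← map_mul]; simp [D]
      rw [mul_comm, ← mul_assoc, mul_comm (_ - _), ← this, mul_div_cancel₀ _ hD]
      rfl
    have : φ.comp σ = ι := by
      refine algHom_ext' (algHom_ext ?_) ?_
      · simpa [σ] using hX
      · simpa [σ] using hY
    exact DFunLike.congr_fun this H
  exact isBirationallyElliptic_of_algHom ⟨isUnit_iff_ne_zero.mpr hΔ⟩ φ hker hrange

end

/-! ### The elliptic fibration -/

theorem mem_levelCurve_iff (P : Params) (ha₀ : P.a ≠ 0) (c d : ℂ) (p : C3) :
    p ∈ levelCurve U₁ (I₁ P) (I₂ P) c d ↔ p 0 ≠ 0 ∧ p 1 = c / P.a + (P.a - 1) / P.a * p 2 ∧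
      fibreCubic (P.a - 1) (fibE P c) (P.κ * P.β) (fibQ P c) (fibM P c - d)
        (p 0) (P.κ * p 2) = 0 := by
  have h1 : I₁ P p = c ↔ p 1 = c / P.a + (P.a - 1) / P.a * p 2 := by
    unfold I₁
    field_simp
    exact sub_eq_iff_eq_add
  have h2 : p 0 ≠ 0 → I₁ P p = c → (I₂ P p = d ↔ fibreCubic (P.a - 1) (fibE P c) (P.κ * P.β)
      (fibQ P c) (fibM P c - d) (p 0) (P.κ * p 2) = 0) := by
    intro hx hc
    rw [I₂, div_eq_iff hx, h_eq, hc, fibreCubic, fibreCubic]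
    constructor <;> intro h <;> linear_combination h
  constructor
  · rintro ⟨hx, hc, hd⟩
    exact ⟨hx, h1.mp hc, (h2 hx hc).mp hd⟩
  · rintro ⟨hx, hc, hd⟩
    exact ⟨hx, h1.mpr hc, (h2 hx (h1.mpr hc)).mpr hd⟩

/-- The discriminant is a quartic polynomial in `s` with leading coefficient `-27 b⁴`. -/
theorem exists_discriminant_ne_zero {b e f q : ℂ} (hb : b ≠ 0) :
    ∃ s, (fibreWeierstrass b e f q s).Δ ≠ 0 := by
  by_contra! h
  -- the fourth difference of the quartic
  have : 24 * (-27 * b ^ 4) = 0 := by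
    have e0 := h 0
    have e1 := h 1
    have e2 := h 2
    have e3 := h 3
    have e4 := h 4
    simp only [fibreWeierstrass, WeierstrassCurve.Δ, WeierstrassCurve.b₂, WeierstrassCurve.b₄,
      WeierstrassCurve.b₆, WeierstrassCurve.b₈] at e0 e1 e2 e3 e4
    linear_combination e4 - 4 * e3 + 6 * e2 - 4 * e1 + e0
  simp [hb] at this

theorem isEllipticFibration (P : Params) (ha₀ : P.a ≠ 0) (ha₁ : P.a ≠ 1) (hκ : P.κ ≠ 0) :
    IsEllipticFibration U₁ (I₁ P) (I₂ P) := by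
  have ha : P.a - 1 ≠ 0 := sub_ne_zero.mpr ha₁
  refine ⟨fun c d => ?_, ?_⟩
  -- the cubic has a point with `x = 1`, as it is monic in `Z`
  · obtain ⟨Z, hZ⟩ := exists_quadratic_eq_zero (a := (1 : ℂ))
      (b := -(P.a - 1) + fibE P c + P.κ * P.β) (c := fibQ P c + (fibM P c - d)) one_ne_zero
      (IsAlgClosed.exists_eq_mul_self _)
    refine ⟨![1, c / P.a + (P.a - 1) / P.a * (Z / P.κ), Z / P.κ],
      (mem_levelCurve_iff P ha₀ c d _).mpr ⟨by simp, by simp, ?_⟩⟩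
    simp only [Matrix.cons_val, mul_div_cancel₀ _ hκ, fibreCubic]
    linear_combination hZ
  · let t : MvPolynomial (Fin 2) ℂ := MvPolynomial.X 0
    let k : ℂ → MvPolynomial (Fin 2) ℂ := MvPolynomial.C
    -- the discriminant of the Weierstrass model, with the values of `I₁`, `I₂` as indeterminates
    let D := (fibreWeierstrass (k (P.a - 1))
      (k ((P.a - 1) * P.κ) - 2 * t - k (P.a * P.γ + 2 * P.a * P.n + P.β))
      (k (P.κ * P.β))
      (t * (k (P.a * P.γ + 2 * P.a * P.n - P.α - P.γ - 2 * P.n) + t)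
        + k ((P.a - 1) * P.a * P.n * (P.γ + P.n)))
      (k P.κ * (t * k (P.κ - P.β) + k (P.a * P.n * (P.γ + P.n))) - MvPolynomial.X 1)).Δ
    have hD : ∀ c d, MvPolynomial.eval ![c, d] D = (fibreWeierstrass (P.a - 1) (fibE P c)
        (P.κ * P.β) (fibQ P c) (fibM P c - d)).Δ := by
      intro c d
      rw [← WeierstrassCurve.map_Δ]
      congr 1
      simp [fibreWeierstrass, WeierstrassCurve.map, fibE, fibQ, fibM, k, t]
    refine ⟨D, fun c => ?_, fun c d hcd => ?_⟩
    · obtain ⟨s, hs⟩ := exists_discriminant_ne_zero (b := P.a - 1) (e := fibE P c)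
        (f := P.κ * P.β) (q := fibQ P c) ha
      exact ⟨fibM P c - s, by rwa [hD, sub_sub_cancel]⟩
    · rw [hD] at hcd
      refine ⟨fun p hp => ?_, isBirationallyElliptic_of_fibreCubic ha hκ hcd
        (mem_levelCurve_iff P ha₀ c d)⟩
      have hp' := ((mem_levelCurve_iff P ha₀ c d p).mp hp).2.2
      obtain ⟨hU, rfl, rfl⟩ := hp
      exact linearIndependent_fderiv_of_cross_ne_zero
        (cross_ne_zero_of_fibreCubic_smooth ha₀ ha₁ hκ hU (fibreCubic_smooth hcd hp'))

end AutonomousLimit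

end

open AutonomousLimit in
theorem mainTheorem5 (P : AutonomousLimit.Params)
    (ha₀ : P.a ≠ 0) (ha₁ : P.a ≠ 1) (hκ : P.κ ≠ 0) :
    -- two functionally independent first integrals
    (IsFirstIntegral (field P) U₁ (I₁ P) ∧ IsFirstIntegral (field P) U₁ (I₂ P) ∧
      FunctionallyIndependent U₁ (I₁ P) (I₂ P)) ∧
    -- two preserved volume forms
    (PreservesVolume (field P) U₁ w₁ ∧ PreservesVolume (field P) (U₂ P) (w₂ P)) ∧
    -- the level curves form an elliptic fibration
    IsEllipticFibration U₁ (I₁ P) (I₂ P) ∧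
    -- two pairs of Poisson structures
    (IsPoissonPair U₁ (contractedTensor w₁ (I₁ P)) (contractedTensor w₁ (I₂ P)) ∧
      IsPoissonPair (U₂ P) (contractedTensor (w₂ P) (I₁ P)) (contractedTensor (w₂ P) (I₂ P))) ∧
    -- the system is Hamiltonian with respect to each of the four structures
    (IsHamiltonianOn (field P) U₁ (contractedTensor w₁ (I₁ P))
        (fun p => hamConst P * I₂ P p) ∧
      IsHamiltonianOn (field P) U₁ (contractedTensor w₁ (I₂ P))
        (fun p => -hamConst P * I₁ P p) ∧
      (∀ p ∈ U₂ P, ∃ V : Set C3, IsOpen V ∧ p ∈ V ∧ V ⊆ U₂ P ∧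
        ∃ L : C3 → ℂ, (∀ q ∈ V, Complex.exp (L q) = I₂ P q) ∧
          IsHamiltonianOn (field P) V (contractedTensor (w₂ P) (I₁ P))
            (fun q => hamConst P * L q)) ∧
      IsHamiltonianOn (field P) (U₂ P) (contractedTensor (w₂ P) (I₂ P))
        (fun p => -hamConst P * (I₁ P p / I₂ P p))) := by
  refine ⟨⟨isFirstIntegral_I₁ P ha₀ ha₁ hκ, isFirstIntegral_I₂ P ha₀ ha₁ hκ,
      functionallyIndependent P ha₀ ha₁ hκ⟩,
    ⟨preservesVolume_w₁ P ha₀ ha₁ hκ, preservesVolume_w₂ P ha₀ ha₁ hκ⟩,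
    isEllipticFibration P ha₀ ha₁ hκ, ⟨isPoissonPair_w₁ P, isPoissonPair_w₂ P⟩,
    isHamiltonianOn_w₁_I₁ P ha₀ ha₁ hκ, isHamiltonianOn_w₁_I₂ P ha₀ ha₁ hκ, fun p hp => ?_,
    isHamiltonianOn_w₂_I₂ P ha₀ ha₁ hκ⟩
  obtain ⟨V, hV, hpV, hVU, Λ, hΛ, hexp⟩ := exists_log_branch P hp
  exact ⟨V, hV, hpV, hVU, Λ, hexp, isHamiltonianOn_w₂_I₁ P ha₀ ha₁ hκ hV hVU hΛ hexp⟩
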